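/- Let $n>3$ be an integer, let $x_0\in\mathbb R^n$ be the unit vector in the first coordinate direction and $y_0=-x_0$. Let $\phi:\mathbb R\to\mathbb R$ be a $C^\infty$ function supported in $[6,8]$, and let $F:\mathbb R\to\mathbb R$ be a nonnegative $C^\infty$ function with $F(s)=0$ for all $s\le 0$ and $F(s)=s$ for all $s\ge\frac12$. For $0\le\alpha<\frac{n-3}{2}$ let $X=X_\alpha$ be the completion of the space of $C^\infty$ functions $f$ on $\mathbb R^n$ with $\operatorname{supp} f\subset B(0,5)\setminus B(0,\tfrac52)$ with respect to the $W^{\alpha,\infty}$-norm $$\|f\|_X:=\|(1-\Delta)^{\alpha/2}f\|_{L^\infty},\qquad \Delta=\sum_{i=1}^n\partial_i^2 ,$$ where $(1-\Delta)^{\alpha/2}$ is the Fourier multiplier operator with symbol $(1+|\xi|^2)^{\alpha/2}$ (in the convention in which $-\Delta$ has symbol $|\xi|^2$). Then there exists a constant $C_n>0$, depending only on $n$, $\phi$ and $F$, such that for every $\alpha\in[0,\frac{n-3}2)$ and every $0<t\le 1$ the function $$V_t(x)=C_n\,t^{\alpha}\,\phi\big(|x_0-x|+|x-y_0|\big)\,F\!\left(\cos\!\left(\frac{(|x_0-x|+|x-y_0|)^2}{4t}\right)\right),\qquad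 x\in\mathbb R^n,$$ is a $C^\infty$ function supported in $B(0,5)\setminus B(0,\tfrac52)$, hence an element of $X_\alpha$, and satisfies $\|V_t\|_{X_\alpha}\le 1$. -/

import Mathlib

open scoped SchwartzMap ContDiff

noncomputable section

namespace Dispersive

/-- Euclidean space `ℝⁿ`. -/
abbrev E (n : ℕ) : Type := EuclideanSpace ℝ (Fin n)

/-- The symbol `ξ ↦ (1 + 4π²|ξ|²)^(α/2)`. With the convention
`𝓕 f ξ = ∫ exp(-2πi⟨x, ξ⟩) f(x) dx` it is the Fourier symbol of `(1 - Δ)^(α/2)`,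
where `Δ = ∑ ∂ᵢ²`. -/
def besselSymbol (n : ℕ) (α : ℝ) (ξ : E n) : ℝ :=
  (1 + ‖(2 * Real.pi) • ξ‖ ^ 2) ^ (α / 2)

theorem besselSymbol_hasTemperateGrowth (n : ℕ) (α : ℝ) :
    (besselSymbol n α).HasTemperateGrowth := by
  have h1 : (fun ξ : E n => (2 * Real.pi) • ξ).HasTemperateGrowth :=
    ((2 * Real.pi) • ContinuousLinearMap.id ℝ (E n)).hasTemperateGrowth
  exact (Function.hasTemperateGrowth_one_add_norm_sq_rpow (E n) (α / 2)).comp h1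

/-- The operator `(1 - Δ)^(α/2)` on complex-valued Schwartz functions on `ℝⁿ`. -/
def bessel (n : ℕ) (α : ℝ) : 𝓢(E n, ℂ) →L[ℂ] 𝓢(E n, ℂ) :=
  SchwartzMap.fourierMultiplierCLM ℂ (fun ξ => (besselSymbol n α ξ : ℂ))

theorem bessel_neg_bessel (n : ℕ) (α : ℝ) (f : 𝓢(E n, ℂ)) :
    bessel n (-α) (bessel n α f) = f := by
  have hg : ∀ β : ℝ, (fun ξ => (besselSymbol n β ξ : ℂ)).HasTemperateGrowth := fun β => by
    have := besselSymbol_hasTemperateGrowth n β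
    fun_prop
  unfold bessel
  rw [SchwartzMap.fourierMultiplierCLM_fourierMultiplierCLM_apply (hg _) (hg _)]
  have h1 : ((fun ξ => (besselSymbol n (-α) ξ : ℂ)) * fun ξ => (besselSymbol n α ξ : ℂ))
      = fun _ => (1 : ℂ) := by
    funext ξ
    simp only [Pi.mul_apply, besselSymbol]
    rw [← Complex.ofReal_mul, ← Real.rpow_add (by positivity)]
    ring_nf
    simp
  rw [h1]
  simp

/-- The region `B(0,5) \ B(0,5/2)` in which the potentials are supported. -/
def shell (n : ℕ) : Set (E n) := Metric.ball 0 5 \ Metric.ball 0 (5 / 2)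

/-- The smooth functions on `ℝⁿ` with support in `B(0,5) \ B(0,5/2)`. Their supports are compact,
so they are Schwartz functions. -/
def smoothOnShell (n : ℕ) : Submodule ℂ 𝓢(E n, ℂ) where
  carrier := {f | tsupport (f : E n → ℂ) ⊆ shell n}
  zero_mem' := by
    change tsupport (0 : E n → ℂ) ⊆ shell n
    simp
  add_mem' := by
    intro f g hf hg
    exact (tsupport_add (f : E n → ℂ) (g : E n → ℂ)).trans (Set.union_subset hf hg)
  smul_mem' := by
    intro c f hf
    exact (closure_mono (Function.support_const_smul_subset c (f : E n → ℂ))).trans hf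

/-- The smooth functions supported in `B(0,5) \ B(0,5/2)`, to be given the norm of order `α`. -/
def SmoothX (n : ℕ) (_α : ℝ) : Type := smoothOnShell n

instance (n : ℕ) (α : ℝ) : AddCommGroup (SmoothX n α) :=
  inferInstanceAs (AddCommGroup (smoothOnShell n))

instance (n : ℕ) (α : ℝ) : Module ℂ (SmoothX n α) :=
  inferInstanceAs (Module ℂ (smoothOnShell n))

/-- The Schwartz function underlying an element of `SmoothX n α`. -/
def SmoothX.toSchwartz (n : ℕ) (α : ℝ) : SmoothX n α →ₗ[ℂ] 𝓢(E n, ℂ) :=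
  (smoothOnShell n).subtype

/-- The map `f ↦ (1 - Δ)^(α/2) f` into the bounded continuous functions with the sup norm. -/
def SmoothX.toBounded (n : ℕ) (α : ℝ) :
    SmoothX n α →ₗ[ℂ] BoundedContinuousFunction (E n) ℂ :=
  (SchwartzMap.toBoundedContinuousFunctionCLM ℂ (E n) ℂ).toLinearMap ∘ₗ
    (bessel n α).toLinearMap ∘ₗ SmoothX.toSchwartz n α

theorem SmoothX.toBounded_injective (n : ℕ) (α : ℝ) :
    Function.Injective (SmoothX.toBounded n α) := by
  intro f g h
  have h1 : bessel n α (SmoothX.toSchwartz n α f) = bessel n α (SmoothX.toSchwartz n α g) :=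
    SchwartzMap.toBoundedContinuousFunctionCLM_injective ℂ (E n) ℂ h
  have h2 : SmoothX.toSchwartz n α f = SmoothX.toSchwartz n α g := by
    rw [← bessel_neg_bessel n α (SmoothX.toSchwartz n α f), h1, bessel_neg_bessel]
  exact Subtype.ext h2

/-- The norm `‖f‖ = ‖(1 - Δ)^(α/2) f‖_∞`. -/
instance (n : ℕ) (α : ℝ) : NormedAddCommGroup (SmoothX n α) :=
  NormedAddCommGroup.induced (SmoothX n α) (BoundedContinuousFunction (E n) ℂ)
    (SmoothX.toBounded n α) (SmoothX.toBounded_injective n α)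

instance (n : ℕ) (α : ℝ) : NormedSpace ℂ (SmoothX n α) :=
  NormedSpace.induced ℂ (SmoothX n α) (BoundedContinuousFunction (E n) ℂ)
    (SmoothX.toBounded n α)

/-- The space `X` of potentials: the completion of the smooth functions supported in
`B(0,5) \ B(0,5/2)` in the norm `‖(1 - Δ)^(α/2) f‖_∞`. -/
abbrev X (n : ℕ) (α : ℝ) : Type := UniformSpace.Completion (SmoothX n α)

/-- The unit vector `x₀` in the first coordinate direction. -/
def x₀ (n : ℕ) : E n := WithLp.toLp 2 (fun i => if (i : ℕ) = 0 then 1 else 0)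

/-- The point `y₀ = -x₀`. -/
def y₀ (n : ℕ) : E n := -x₀ n

/-- The length sum `|x₀ - x| + |x - y₀|`. -/
def lengthSum (n : ℕ) (x : E n) : ℝ := ‖x₀ n - x‖ + ‖x - y₀ n‖

/-- The potential
`V_t(x) = C t^α φ(|x₀ - x| + |x - y₀|) F(cos((|x₀ - x| + |x - y₀|)² / (4t)))`. -/
def potential (n : ℕ) (φ F : ℝ → ℝ) (C α t : ℝ) (x : E n) : ℝ :=
  C * t ^ α * φ (lengthSum n x) * F (Real.cos (lengthSum n x ^ 2 / (4 * t)))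

end Dispersive

end

namespace Dispersive

open MeasureTheory Filter Topology Laplacian LineDeriv FourierTransform

/-! ### The maximum principle for the resolvent of the Laplacian -/

/-! Put `T = 1/t ≥ 1` and `A = 1 - Δ`. Up to the factor `C t^α` the potential is `w = φ(L) F(cos(T
L²/4))`, where `L` is the length sum. On the compact set `6 ≤ L ≤ 8`, which avoids the foci, `L` is
smooth, so derivatives of `w` of order `j` are `O(T^j)`
(`exists_norm_iteratedFDeriv_profile_comp_lengthSum_le`). It remains to deduce `‖A^(α/2) w‖_∞ ≤ B
T^α` with `B` independent of `α` and `T`; then `t^α` cancels `T^α`.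

Integer powers of `A` are differential operators. A fractional part `0 < θ < 1` is handled by
Balakrishnan's formula `c_θ A^θ f = ∫₀^∞ s^(θ-1) A (s + A)⁻¹ f ds`. The maximum principle gives `s
‖(s + A)⁻¹ f‖_∞ ≤ ‖f‖_∞`, so the integrand is controlled by `2‖f‖_∞` for small `s` and by `‖A f‖_∞ /
s` for large `s`. Splitting the integral gives the interpolation inequality
`norm_bessel_two_mul_le`. Its constants are uniform in `θ` because `c_θ` blows up at both endpoints
at the same rate as the split integrals. -/

theorem _root_.IsLocalMax.deriv_deriv_nonpos {f : ℝ → ℝ} {a : ℝ} (h : IsLocalMax f a)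
    (hf : ContinuousAt f a) : deriv (deriv f) a ≤ 0 := by
  by_contra! hpos
  -- A point that is both a local maximum and a local minimum has a neighbourhood where `f` is
  -- constant, so the second derivative vanishes.
  have hmin := isLocalMin_of_deriv_deriv_pos hpos h.deriv_eq_zero hf
  have hconst : f =ᶠ[𝓝 a] fun _ => f a := by
    filter_upwards [h, hmin] with x h1 h2 using le_antisymm h1 h2
  have := hconst.deriv.deriv_eq
  simp at this
  exact hpos.ne' this

variable {V : Type*} [NormedAddCommGroup V] [InnerProductSpace ℝ V]

theorem hasDerivAt_comp_line (u : 𝓢(V, ℂ)) (p e : V) (s : ℝ) :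
    HasDerivAt (fun s : ℝ => u (p + s • e)) ((∂_{e} u) (p + s • e)) s := by
  rw [SchwartzMap.lineDerivOp_apply_eq_fderiv]
  have h1 : HasDerivAt (fun s : ℝ => p + s • e) e s := by
    simpa using ((hasDerivAt_id s).smul_const e).const_add p
  exact (u.differentiableAt.hasFDerivAt (x := p + s • e)).comp_hasDerivAt s h1

variable [FiniteDimensional ℝ V]

theorem re_mul_laplacian_nonpos_of_isMax (u : 𝓢(V, ℂ)) (c : ℂ) (p : V)
    (hp : ∀ x, (c * u x).re ≤ (c * u p).re) : (c * (Δ u) p).re ≤ 0 := by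
  rw [SchwartzMap.laplacian_eq_sum (stdOrthonormalBasis ℝ V), sum_apply,
    Finset.mul_sum, Complex.re_sum]
  refine Finset.sum_nonpos fun i _ => ?_
  set e := stdOrthonormalBasis ℝ V i
  have key : ∀ v : 𝓢(V, ℂ), ∀ s : ℝ, HasDerivAt (fun s : ℝ => (c * v (p + s • e)).re)
      (c * (∂_{e} v) (p + s • e)).re s := fun v s =>
    Complex.reCLM.hasFDerivAt.comp_hasDerivAt s ((hasDerivAt_comp_line v p e s).const_mul c)
  have hmax : IsLocalMax (fun s : ℝ => (c * u (p + s • e)).re) 0 :=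
    Eventually.of_forall fun s => by simpa using hp (p + s • e)
  have h2 := hmax.deriv_deriv_nonpos (key u 0).continuousAt
  have h3 : deriv (fun s : ℝ => (c * u (p + s • e)).re)
      = fun s => (c * (∂_{e} u) (p + s • e)).re := funext fun s => (key u s).deriv
  rw [h3, (key _ 0).deriv] at h2
  simpa using h2

/-- Since `u` decays, `‖u‖` attains its maximum at some `p`. A unimodular `c` makes `c u(p)` equal
to `‖u(p)‖`; then `Re (c u)` is also maximal at `p`, so `-Re (c Δu(p)) ≥ 0` only helps. -/
theorem mul_norm_le_of_norm_mul_sub_laplacian_le (u : 𝓢(V, ℂ)) {μ M : ℝ}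
    (hμ : 0 ≤ μ) (h : ∀ x, ‖μ * u x - (Δ u) x‖ ≤ M) (x : V) : μ * ‖u x‖ ≤ M := by
  obtain ⟨p, hp⟩ : ∃ p, ∀ x, ‖u x‖ ≤ ‖u p‖ := by
    by_cases h0 : ∀ x, u x = 0
    · exact ⟨0, fun x => by simp [h0]⟩
    · push Not at h0
      obtain ⟨y, hy⟩ := h0
      refine u.continuous.norm.exists_forall_ge' y ?_
      have := u.tendsto_cocompact.norm
      rw [norm_zero] at this
      exact (this.eventually (gt_mem_nhds (norm_pos_iff.2 hy))).mono fun _ h => h.le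
  refine (mul_le_mul_of_nonneg_left (hp x) hμ).trans ?_
  obtain ⟨c, hc, hcu⟩ : ∃ c : ℂ, ‖c‖ = 1 ∧ c * u p = ‖u p‖ := by
    by_cases h0 : u p = 0
    · exact ⟨1, by simp [h0]⟩
    · have h1 : (‖u p‖ : ℂ) ≠ 0 := by simpa using h0
      refine ⟨(‖u p‖ : ℂ) / u p, by simp [h0], by field_simp⟩
  have hL : (c * (Δ u) p).re ≤ 0 := by
    refine re_mul_laplacian_nonpos_of_isMax u c p fun x => ?_
    rw [hcu, Complex.ofReal_re]
    exact (Complex.re_le_norm _).trans (by simpa [hc] using hp x)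
  calc μ * ‖u p‖ = (c * (μ * u p)).re := by
        rw [mul_left_comm, hcu, ← Complex.ofReal_mul, Complex.ofReal_re]
    _ ≤ (c * (μ * u p - (Δ u) p)).re := by rw [mul_sub, Complex.sub_re]; linarith
    _ ≤ ‖c * (μ * u p - (Δ u) p)‖ := Complex.re_le_norm _
    _ ≤ M := by rw [norm_mul, hc, one_mul]; exact h p

/-! ### Powers of `1 - Δ` and its resolvent -/

theorem besselSymbol_hasTemperateGrowth_complex (n : ℕ) (α : ℝ) :
    (fun ξ => (besselSymbol n α ξ : ℂ)).HasTemperateGrowth := by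
  have := besselSymbol_hasTemperateGrowth n α
  fun_prop

theorem besselSymbol_two (n : ℕ) (ξ : E n) :
    besselSymbol n 2 ξ = 1 + ‖(2 * Real.pi) • ξ‖ ^ 2 := by
  simp [besselSymbol]

theorem besselSymbol_pos (n : ℕ) (α : ℝ) (ξ : E n) : 0 < besselSymbol n α ξ := by
  unfold besselSymbol; positivity

theorem besselSymbol_eq_rpow (n : ℕ) (θ : ℝ) (ξ : E n) :
    besselSymbol n (2 * θ) ξ = besselSymbol n 2 ξ ^ θ := by
  rw [besselSymbol_two, besselSymbol, mul_div_cancel_left₀ θ two_ne_zero]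

theorem bessel_zero (n : ℕ) (f : 𝓢(E n, ℂ)) : bessel n 0 f = f := by
  simp [bessel, besselSymbol]

theorem bessel_bessel (n : ℕ) (α β : ℝ) (f : 𝓢(E n, ℂ)) :
    bessel n α (bessel n β f) = bessel n (α + β) f := by
  unfold bessel
  rw [SchwartzMap.fourierMultiplierCLM_fourierMultiplierCLM_apply
    (besselSymbol_hasTemperateGrowth_complex n _) (besselSymbol_hasTemperateGrowth_complex n _)]
  congr 2
  funext ξ
  simp only [Pi.mul_apply, besselSymbol]
  rw [← Complex.ofReal_mul, ← Real.rpow_add (by positivity), add_div]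

theorem fourierMultiplierCLM_add_apply {g h : V → ℂ} (hg : g.HasTemperateGrowth)
    (hh : h.HasTemperateGrowth) [MeasurableSpace V] [BorelSpace V] (f : 𝓢(V, ℂ)) :
    SchwartzMap.fourierMultiplierCLM ℂ (fun ξ => g ξ + h ξ) f
      = SchwartzMap.fourierMultiplierCLM ℂ g f + SchwartzMap.fourierMultiplierCLM ℂ h f := by
  have := SchwartzMap.fourierMultiplierCLM_sum ℂ (s := Finset.univ)
    (g := fun i : Bool => bif i then g else h) (by rintro (_ | _) _ <;> assumption)
  simp only [Fintype.sum_bool, cond_true, cond_false] at this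
  rw [this, add_apply]

theorem fourierMultiplierCLM_norm_sq_apply [MeasurableSpace V] [BorelSpace V] (f : 𝓢(V, ℂ)) :
    SchwartzMap.fourierMultiplierCLM ℂ (fun ξ : V => ((‖ξ‖ ^ 2 : ℝ) : ℂ)) f
      = (-((2 * Real.pi) ^ 2)⁻¹ : ℝ) • Δ f := by
  have h1 : (fun ξ : V => ((‖ξ‖ ^ 2 : ℝ) : ℂ)) = fun ξ : V => RCLike.ofReal (‖ξ‖ ^ 2) := rfl
  have hg : (fun ξ : V => ‖ξ‖ ^ 2).HasTemperateGrowth := by fun_prop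
  have h2 := SchwartzMap.fourierMultiplierCLM_ofReal ℂ hg f
  have h3 : (fun ξ : V => ‖ξ‖ ^ 2) = (‖·‖ ^ 2) := rfl
  rw [h1, h2, SchwartzMap.laplacian_eq_fourierMultiplierCLM, smul_smul, h3, neg_mul_neg,
    inv_mul_cancel₀ (by positivity), one_smul]

theorem bessel_two (n : ℕ) (f : 𝓢(E n, ℂ)) : bessel n 2 f = f - Δ f := by
  have hg : (fun ξ : E n => ((‖ξ‖ ^ 2 : ℝ) : ℂ)).HasTemperateGrowth := by fun_prop
  set c : ℂ := (((2 * Real.pi) ^ 2 : ℝ) : ℂ) with hc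
  have h1 : (fun ξ : E n => (besselSymbol n 2 ξ : ℂ))
      = fun ξ => (1 : ℂ) + (c • fun ξ : E n => ((‖ξ‖ ^ 2 : ℝ) : ℂ)) ξ := by
    funext ξ
    rw [besselSymbol_two]
    simp [norm_smul, mul_pow, hc]
  have h3 : (c • fun ξ : E n => ((‖ξ‖ ^ 2 : ℝ) : ℂ)).HasTemperateGrowth :=
    (Function.HasTemperateGrowth.const c).mul hg
  have h4 : SchwartzMap.fourierMultiplierCLM ℂ (fun _ : E n => (1 : ℂ)) f = f := by simp
  rw [bessel, h1, fourierMultiplierCLM_add_apply (.const 1) h3, h4,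
    SchwartzMap.fourierMultiplierCLM_smul hg, smul_apply, fourierMultiplierCLM_norm_sq_apply, hc,
    Complex.coe_smul, smul_smul, mul_neg, mul_inv_cancel₀ (by positivity), neg_one_smul,
    sub_eq_add_neg]

theorem resolventSymbol_hasTemperateGrowth (n : ℕ) {s : ℝ} (hs : 0 ≤ s) :
    (fun ξ : E n => (((s + besselSymbol n 2 ξ)⁻¹ : ℝ) : ℂ)).HasTemperateGrowth := by
  -- This dilation turns the symbol into `(s + 1)⁻¹ (1 + ‖·‖²)⁻¹`.
  have h1 : (fun ξ : E n => ((2 * Real.pi) / √(s + 1)) • ξ).HasTemperateGrowth :=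
    (((2 * Real.pi) / √(s + 1)) • ContinuousLinearMap.id ℝ (E n)).hasTemperateGrowth
  have h2 := (Function.hasTemperateGrowth_one_add_norm_sq_rpow (E n) (-1)).comp h1
  have h3 : (fun ξ : E n => (s + besselSymbol n 2 ξ)⁻¹) = fun ξ =>
      (s + 1)⁻¹ * ((fun ξ : E n => (1 + ‖ξ‖ ^ 2) ^ (-1 : ℝ)) ∘
        fun ξ : E n => ((2 * Real.pi) / √(s + 1)) • ξ) ξ := by
    funext ξ
    have : 0 < s + 1 := by linarith
    rw [besselSymbol_two, Function.comp_apply, Real.rpow_neg_one, ← mul_inv, norm_smul, norm_smul,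
      mul_pow, mul_pow, norm_div, div_pow, Real.norm_of_nonneg (Real.sqrt_nonneg _),
      Real.sq_sqrt this.le]
    congr 1
    field_simp
    ring
  have h4 : (fun ξ : E n => (s + besselSymbol n 2 ξ)⁻¹).HasTemperateGrowth := by
    rw [h3]; exact (Function.HasTemperateGrowth.const _).mul h2
  fun_prop

/-- The resolvent `(s + 1 - Δ)⁻¹`. -/
noncomputable def resolvent (n : ℕ) (s : ℝ) : 𝓢(E n, ℂ) →L[ℂ] 𝓢(E n, ℂ) :=
  SchwartzMap.fourierMultiplierCLM ℂ fun ξ => (((s + besselSymbol n 2 ξ)⁻¹ : ℝ) : ℂ)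

theorem smul_resolvent_add_bessel_resolvent (n : ℕ) {s : ℝ} (hs : 0 ≤ s) (f : 𝓢(E n, ℂ)) :
    (s : ℂ) • resolvent n s f + bessel n 2 (resolvent n s f) = f := by
  have hr := resolventSymbol_hasTemperateGrowth n hs
  have hb := besselSymbol_hasTemperateGrowth_complex n 2
  have hc : (fun _ : E n => (s : ℂ)).HasTemperateGrowth := .const _
  have h1 : (s : ℂ) • resolvent n s f
      = SchwartzMap.fourierMultiplierCLM ℂ (fun _ : E n => (s : ℂ)) (resolvent n s f) := by simp
  rw [h1, bessel, resolvent, SchwartzMap.fourierMultiplierCLM_fourierMultiplierCLM_apply hc hr,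
    SchwartzMap.fourierMultiplierCLM_fourierMultiplierCLM_apply hb hr]
  rw [← fourierMultiplierCLM_add_apply (hc.mul hr) (hb.mul hr)]
  have h3 : (fun ξ : E n => (s : ℂ) * (((s + besselSymbol n 2 ξ)⁻¹ : ℝ) : ℂ)
      + (besselSymbol n 2 ξ : ℂ) * (((s + besselSymbol n 2 ξ)⁻¹ : ℝ) : ℂ)) = fun _ => 1 := by
    funext ξ
    have h4 : s + besselSymbol n 2 ξ ≠ 0 := by linarith [besselSymbol_pos n 2 ξ]
    rw [← add_mul, ← Complex.ofReal_add, ← Complex.ofReal_mul, mul_inv_cancel₀ h4,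
      Complex.ofReal_one]
  simp only [Pi.mul_apply, h3]
  simp

theorem bessel_resolvent_comm (n : ℕ) {s : ℝ} (hs : 0 ≤ s) (f : 𝓢(E n, ℂ)) :
    bessel n 2 (resolvent n s f) = resolvent n s (bessel n 2 f) := by
  have hr := resolventSymbol_hasTemperateGrowth n hs
  have hb := besselSymbol_hasTemperateGrowth_complex n 2
  rw [bessel, resolvent, SchwartzMap.fourierMultiplierCLM_fourierMultiplierCLM_apply hb hr,
    SchwartzMap.fourierMultiplierCLM_fourierMultiplierCLM_apply hr hb, mul_comm]

/-- The maximum principle with `μ = s + 1`; the surplus `1` is discarded. -/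
theorem mul_norm_resolvent_le (n : ℕ) {s M : ℝ} (hs : 0 ≤ s) {f : 𝓢(E n, ℂ)}
    (hf : ∀ x, ‖f x‖ ≤ M) (x : E n) : s * ‖resolvent n s f x‖ ≤ M := by
  have h := mul_norm_le_of_norm_mul_sub_laplacian_le (resolvent n s f) (μ := s + 1) (M := M)
    (by linarith) (fun y => ?_) x
  · nlinarith [norm_nonneg (resolvent n s f x)]
  · have h1 := congrArg (fun g : 𝓢(E n, ℂ) => g y) (smul_resolvent_add_bessel_resolvent n hs f)
    simp only [bessel_two, add_apply, sub_apply,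
      smul_apply, smul_eq_mul] at h1
    calc _ = ‖f y‖ := by rw [← h1]; congr 1; push_cast; ring
      _ ≤ M := hf y

/-- From `A (s + A)⁻¹ = 1 - s (s + A)⁻¹`. This is the bound used for small `s`. -/
theorem norm_bessel_resolvent_le_two_mul (n : ℕ) {s M : ℝ} (hs : 0 ≤ s) {f : 𝓢(E n, ℂ)}
    (hf : ∀ x, ‖f x‖ ≤ M) (x : E n) : ‖bessel n 2 (resolvent n s f) x‖ ≤ 2 * M := by
  have h1 : bessel n 2 (resolvent n s f) x = f x - s * resolvent n s f x := by
    conv_rhs => enter [1]; rw [← smul_resolvent_add_bessel_resolvent n hs f]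
    simp
  rw [h1]
  refine (norm_sub_le _ _).trans ?_
  rw [norm_mul, Complex.norm_real, Real.norm_of_nonneg hs]
  linarith [hf x, mul_norm_resolvent_le n hs hf x]

theorem mul_norm_bessel_resolvent_le (n : ℕ) {s M : ℝ} (hs : 0 ≤ s) {f : 𝓢(E n, ℂ)}
    (hf : ∀ x, ‖bessel n 2 f x‖ ≤ M) (x : E n) : s * ‖bessel n 2 (resolvent n s f) x‖ ≤ M := by
  rw [bessel_resolvent_comm n hs]
  exact mul_norm_resolvent_le n hs hf x

end Dispersive

namespace Dispersive

open MeasureTheory Set FourierTransform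

/-! ### Balakrishnan's formula for fractional powers -/

theorem integrableOn_Ioc_rpow_sub_one {θ : ℝ} (h0 : 0 < θ) {b : ℝ} (hb : 0 ≤ b) :
    IntegrableOn (fun s : ℝ => s ^ (θ - 1)) (Ioc 0 b) :=
  (intervalIntegrable_iff_integrableOn_Ioc_of_le hb).1
    (intervalIntegral.intervalIntegrable_rpow' (by linarith))

theorem integral_Ioc_rpow_sub_one {θ : ℝ} (h0 : 0 < θ) {b : ℝ} (hb : 0 ≤ b) :
    ∫ s in Ioc 0 b, s ^ (θ - 1) = b ^ θ / θ := by
  rw [← intervalIntegral.integral_of_le hb, integral_rpow (Or.inl (by linarith)),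
    sub_add_cancel, Real.zero_rpow h0.ne', sub_zero]

theorem integral_Ioi_rpow_sub_two {θ : ℝ} (h1 : θ < 1) {b : ℝ} (hb : 0 < b) :
    ∫ s in Ioi b, s ^ (θ - 2) = b ^ (θ - 1) / (1 - θ) := by
  rw [integral_Ioi_rpow_of_lt (by linarith) hb, show θ - 2 + 1 = -(1 - θ) by ring,
    neg_div_neg_eq, show -(1 - θ) = θ - 1 by ring]

theorem integrableOn_rpow_div_one_add {θ : ℝ} (h0 : 0 < θ) (h1 : θ < 1) :
    IntegrableOn (fun s : ℝ => s ^ (θ - 1) / (1 + s)) (Ioi 0) := by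
  have hm : Measurable fun s : ℝ => s ^ (θ - 1) / (1 + s) := by fun_prop
  rw [← Ioc_union_Ioi_eq_Ioi zero_le_one]
  refine IntegrableOn.union ?_ ?_
  · refine (integrableOn_Ioc_rpow_sub_one h0 zero_le_one).mono' hm.aestronglyMeasurable ?_
    filter_upwards [ae_restrict_mem measurableSet_Ioc] with s hs
    have := hs.1
    rw [Real.norm_of_nonneg (by positivity)]
    exact div_le_self (by positivity) (by linarith)
  · refine (integrableOn_Ioi_rpow_of_lt (a := θ - 2) (by linarith) zero_lt_one).mono'
      hm.aestronglyMeasurable ?_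
    filter_upwards [ae_restrict_mem measurableSet_Ioi] with s hs
    have hs0 : 0 < s := zero_lt_one.trans hs
    rw [Real.norm_of_nonneg (by positivity), show θ - 2 = θ - 1 - 1 by ring,
      Real.rpow_sub_one hs0.ne' (θ - 1)]
    exact div_le_div_of_nonneg_left (by positivity) hs0 (by linarith)

/-- The constant `∫₀^∞ s^(θ-1) / (1+s) ds = π / sin (π θ)`. -/
noncomputable def balakrishnanConst (θ : ℝ) : ℝ := ∫ s in Ioi (0 : ℝ), s ^ (θ - 1) / (1 + s)

/-- Keep only `s ≤ 1`, where `1 + s ≤ 2`. The blow-up as `θ → 0` offsets the factor `1/θ` in `∫₀^δ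
s^(θ-1) ds`. -/
theorem one_div_two_mul_le_balakrishnanConst {θ : ℝ} (h0 : 0 < θ) (h1 : θ < 1) :
    1 / (2 * θ) ≤ balakrishnanConst θ := by
  have hI := integrableOn_rpow_div_one_add h0 h1
  calc 1 / (2 * θ) = ∫ s in Ioc (0 : ℝ) 1, s ^ (θ - 1) / 2 := by
        rw [integral_div, integral_Ioc_rpow_sub_one h0 zero_le_one, Real.one_rpow]
        field_simp
    _ ≤ ∫ s in Ioc (0 : ℝ) 1, s ^ (θ - 1) / (1 + s) := by
        refine setIntegral_mono_on ((integrableOn_Ioc_rpow_sub_one h0 zero_le_one).div_const 2)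
          (hI.mono_set Ioc_subset_Ioi_self) measurableSet_Ioc fun s hs => ?_
        have := hs.1
        gcongr
        linarith [hs.2]
    _ ≤ _ := by
        refine setIntegral_mono_set hI ?_ (Filter.Eventually.of_forall Ioc_subset_Ioi_self)
        filter_upwards [ae_restrict_mem measurableSet_Ioi] with s hs
        have : 0 < s := hs
        simp only [Pi.zero_apply]
        positivity

/-- Keep only `s > 1`, where `1 + s ≤ 2s`; this offsets `1/(1-θ)` as `θ → 1`. -/
theorem one_div_two_mul_one_sub_le_balakrishnanConst {θ : ℝ} (h0 : 0 < θ) (h1 : θ < 1) :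
    1 / (2 * (1 - θ)) ≤ balakrishnanConst θ := by
  have hI := integrableOn_rpow_div_one_add h0 h1
  calc 1 / (2 * (1 - θ)) = ∫ s in Ioi (1 : ℝ), s ^ (θ - 2) / 2 := by
        rw [integral_div, integral_Ioi_rpow_sub_two h1 zero_lt_one, Real.one_rpow]
        field_simp
    _ ≤ ∫ s in Ioi (1 : ℝ), s ^ (θ - 1) / (1 + s) := by
        refine setIntegral_mono_on ((integrableOn_Ioi_rpow_of_lt (by linarith)
          zero_lt_one).div_const 2) (hI.mono_set (Ioi_subset_Ioi zero_le_one))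
          measurableSet_Ioi fun s hs => ?_
        have hs1 : 1 < s := hs
        have hs0 : 0 < s := by linarith
        rw [show θ - 2 = θ - 1 - 1 by ring, Real.rpow_sub_one hs0.ne', div_div]
        gcongr
        linarith
    _ ≤ _ := by
        refine setIntegral_mono_set hI ?_
          (Filter.Eventually.of_forall (Ioi_subset_Ioi zero_le_one))
        filter_upwards [ae_restrict_mem measurableSet_Ioi] with s hs
        have : 0 < s := hs
        simp only [Pi.zero_apply]
        positivity

theorem rpow_mul_div_add_comp_mul {θ a s : ℝ} (ha : 0 < a) (hs : 0 < s) :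
    (a * s) ^ (θ - 1) * (a / (a * s + a)) = a ^ (θ - 1) * (s ^ (θ - 1) / (1 + s)) := by
  rw [Real.mul_rpow ha.le hs.le]
  field_simp
  ring

theorem integrableOn_rpow_mul_div_add {θ : ℝ} (h0 : 0 < θ) (h1 : θ < 1) {a : ℝ} (ha : 0 < a) :
    IntegrableOn (fun s : ℝ => s ^ (θ - 1) * (a / (s + a))) (Ioi 0) := by
  have h := integrableOn_Ioi_comp_mul_left_iff (fun s : ℝ => s ^ (θ - 1) * (a / (s + a))) 0 ha
  rw [mul_zero] at h
  refine h.1 (((integrableOn_rpow_div_one_add h0 h1).const_mul (a ^ (θ - 1))).congr ?_)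
  filter_upwards [ae_restrict_mem measurableSet_Ioi] with s hs
  exact (rpow_mul_div_add_comp_mul ha hs).symm

theorem integral_rpow_mul_div_add (θ : ℝ) {a : ℝ} (ha : 0 < a) :
    ∫ s in Ioi (0 : ℝ), s ^ (θ - 1) * (a / (s + a)) = a ^ θ * balakrishnanConst θ := by
  have h := integral_comp_mul_left_Ioi' (fun s : ℝ => s ^ (θ - 1) * (a / (s + a))) 0 ha
  rw [mul_zero] at h
  rw [← h, setIntegral_congr_fun measurableSet_Ioi
    (fun s hs => rpow_mul_div_add_comp_mul (θ := θ) ha hs), integral_const_mul, smul_eq_mul,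
    ← mul_assoc, Real.rpow_sub_one ha.ne', mul_div_cancel₀ _ ha.ne']
  rfl

theorem fourierMultiplierCLM_apply_eq_integral {n : ℕ} {g : E n → ℂ} (hg : g.HasTemperateGrowth)
    (f : 𝓢(E n, ℂ)) (x : E n) : SchwartzMap.fourierMultiplierCLM ℂ g f x
      = ∫ ξ, g ξ * ((𝐞 (inner ℝ ξ x) : ℂ) * 𝓕 f ξ) := by
  rw [SchwartzMap.fourierMultiplierCLM_apply, SchwartzMap.fourierInv_coe, Real.fourierInv_eq]
  refine integral_congr_ae (Filter.Eventually.of_forall fun ξ => ?_)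
  simp only [SchwartzMap.smulLeftCLM_apply_apply hg, Circle.smul_def, smul_eq_mul]
  ring

/-- On the Fourier side this is the scalar identity `integral_rpow_mul_div_add` at each frequency;
Fubini exchanges the `s` and `ξ` integrals. -/
theorem balakrishnan_formula {n : ℕ} {θ : ℝ} (h0 : 0 < θ) (h1 : θ < 1) (f : 𝓢(E n, ℂ)) (x : E n) :
    (balakrishnanConst θ : ℂ) * bessel n (2 * θ) f x
      = ∫ s in Ioi (0 : ℝ), ((s ^ (θ - 1) : ℝ) : ℂ) * bessel n 2 (resolvent n s f) x := by
  set a : E n → ℝ := besselSymbol n 2 with ha_def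
  have ha : ∀ ξ, 0 < a ξ := besselSymbol_pos n 2
  have ha_cont : Continuous a :=
    (besselSymbol_hasTemperateGrowth n 2).1.continuous
  set g : E n → ℂ := fun ξ => (𝐞 (inner ℝ ξ x) : ℂ) * 𝓕 f ξ with hg_def
  have hg_cont : Continuous g := by
    have := (𝓕 f).continuous
    fun_prop
  set K : ℝ → E n → ℂ := fun s ξ => ((s ^ (θ - 1) * (a ξ / (s + a ξ)) : ℝ) : ℂ) * g ξ with hK
  have hKm : AEStronglyMeasurable (Function.uncurry K)
      ((volume.restrict (Ioi (0 : ℝ))).prod volume) := by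
    have h2 := ha_cont.measurable
    have h3 := hg_cont.measurable
    have : Measurable (Function.uncurry K) := by
      simp only [hK, Function.uncurry_def]
      fun_prop
    exact this.aestronglyMeasurable
  have hKnorm : ∀ ξ, ∀ s ∈ Ioi (0 : ℝ), ‖K s ξ‖ = s ^ (θ - 1) * (a ξ / (s + a ξ)) * ‖g ξ‖ := by
    intro ξ s hs
    have := ha ξ
    have hs' : 0 < s := hs
    rw [hK, norm_mul, Complex.norm_real, Real.norm_of_nonneg (by positivity)]
  have hpow : ∀ ξ, a ξ ^ θ = besselSymbol n (2 * θ) ξ := fun ξ =>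
    (besselSymbol_eq_rpow n θ ξ).symm
  have hint : Integrable (Function.uncurry K) ((volume.restrict (Ioi (0 : ℝ))).prod volume) := by
    refine (integrable_prod_iff' hKm).2 ⟨Filter.Eventually.of_forall fun ξ => ?_, ?_⟩
    · exact ((integrableOn_rpow_mul_div_add h0 h1 (ha ξ)).ofReal).mul_const (g ξ)
    -- Integrating out `s` leaves the norm of a Schwartz function of `ξ`, hence absolute
    -- integrability.
    · have h2 : ∀ ξ, ∫ s in Ioi (0 : ℝ), ‖Function.uncurry K (s, ξ)‖
          = balakrishnanConst θ * ‖SchwartzMap.smulLeftCLM ℂ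
            (fun ξ => (besselSymbol n (2 * θ) ξ : ℂ)) (𝓕 f) ξ‖ := by
        intro ξ
        simp only [Function.uncurry_apply_pair]
        rw [setIntegral_congr_fun measurableSet_Ioi (hKnorm ξ), integral_mul_const,
          integral_rpow_mul_div_add θ (ha ξ), SchwartzMap.smulLeftCLM_apply_apply
            (besselSymbol_hasTemperateGrowth_complex n _), norm_smul, Complex.norm_real,
          Real.norm_of_nonneg (besselSymbol_pos n _ ξ).le, hpow, hg_def, norm_mul,
          Circle.norm_coe]
        ring
      simp_rw [h2]
      exact (SchwartzMap.integrable _).norm.const_mul _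
  have hswap := integral_integral_swap hint
  have hleft : ∀ s ∈ Ioi (0 : ℝ), ∫ ξ, K s ξ
      = ((s ^ (θ - 1) : ℝ) : ℂ) * bessel n 2 (resolvent n s f) x := by
    intro s hs
    have hs' : 0 < s := hs
    have hr := resolventSymbol_hasTemperateGrowth n hs'.le
    have hb := besselSymbol_hasTemperateGrowth_complex n 2
    rw [bessel, resolvent, SchwartzMap.fourierMultiplierCLM_fourierMultiplierCLM_apply hb hr,
      fourierMultiplierCLM_apply_eq_integral (hb.mul hr), ← integral_const_mul]
    refine integral_congr_ae (Filter.Eventually.of_forall fun ξ => ?_)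
    simp only [hK, Pi.mul_apply, div_eq_mul_inv]
    push_cast
    ring
  have hright : ∀ ξ, ∫ s in Ioi (0 : ℝ), K s ξ
      = balakrishnanConst θ * ((besselSymbol n (2 * θ) ξ : ℂ) * g ξ) := by
    intro ξ
    simp only [hK]
    rw [integral_mul_const, integral_complex_ofReal, integral_rpow_mul_div_add θ (ha ξ), hpow]
    push_cast
    ring
  rw [setIntegral_congr_fun measurableSet_Ioi hleft] at hswap
  rw [hswap]
  simp_rw [hright]
  rw [integral_const_mul, bessel, fourierMultiplierCLM_apply_eq_integral
    (besselSymbol_hasTemperateGrowth_complex n _)]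

theorem norm_bessel_two_mul_le {n : ℕ} {θ : ℝ} (h0 : 0 < θ) (h1 : θ < 1) {δ : ℝ} (hδ : 0 < δ)
    {f : 𝓢(E n, ℂ)} {M₀ M₁ : ℝ} (hf₀ : ∀ x, ‖f x‖ ≤ M₀) (hf₁ : ∀ x, ‖bessel n 2 f x‖ ≤ M₁)
    (x : E n) :
    ‖bessel n (2 * θ) f x‖ ≤ 4 * δ ^ θ * M₀ + 2 * δ ^ (θ - 1) * M₁ := by
  have hM₀ : 0 ≤ M₀ := (norm_nonneg _).trans (hf₀ 0)
  have hM₁ : 0 ≤ M₁ := (norm_nonneg _).trans (hf₁ 0)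
  set c := balakrishnanConst θ
  have hc0 := one_div_two_mul_le_balakrishnanConst h0 h1
  have hc1 := one_div_two_mul_one_sub_le_balakrishnanConst h0 h1
  have h1θ : 0 < 1 - θ := by linarith
  have hcpos : 0 < c := lt_of_lt_of_le (by positivity) hc0
  set B : ℝ → ℝ := fun s => ‖((s ^ (θ - 1) : ℝ) : ℂ) * bessel n 2 (resolvent n s f) x‖
  have hB0 : ∀ s, 0 < s → B s ≤ 2 * M₀ * s ^ (θ - 1) := by
    intro s hs
    simp only [B]
    rw [norm_mul, Complex.norm_real, Real.norm_of_nonneg (by positivity), mul_comm]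
    gcongr
    exact norm_bessel_resolvent_le_two_mul n hs.le hf₀ x
  have hB1 : ∀ s, 0 < s → B s ≤ M₁ * s ^ (θ - 2) := by
    intro s hs
    simp only [B]
    rw [norm_mul, Complex.norm_real, Real.norm_of_nonneg (by positivity),
      show θ - 2 = θ - 1 - 1 by ring, Real.rpow_sub_one hs.ne' (θ - 1), mul_div_left_comm]
    gcongr
    rw [le_div_iff₀' hs]
    exact mul_norm_bessel_resolvent_le n hs.le hf₁ x
  set G : ℝ → ℝ := fun s => if s ≤ δ then 2 * M₀ * s ^ (θ - 1) else M₁ * s ^ (θ - 2)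
  have hG0 : EqOn G (fun s => 2 * M₀ * s ^ (θ - 1)) (Ioc 0 δ) := fun s hs => if_pos hs.2
  have hG1 : EqOn G (fun s => M₁ * s ^ (θ - 2)) (Ioi δ) := fun s hs => if_neg (not_le.2 hs)
  have hGi0 : IntegrableOn G (Ioc 0 δ) :=
    (integrableOn_congr_fun hG0 measurableSet_Ioc).2
      ((integrableOn_Ioc_rpow_sub_one h0 hδ.le).const_mul _)
  have hGi1 : IntegrableOn G (Ioi δ) :=
    (integrableOn_congr_fun hG1 measurableSet_Ioi).2
      ((integrableOn_Ioi_rpow_of_lt (by linarith) hδ).const_mul _)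
  have hle : c * ‖bessel n (2 * θ) f x‖ ≤ ∫ s in Ioi (0 : ℝ), G s := by
    have := congrArg norm (balakrishnan_formula h0 h1 f x)
    rw [norm_mul, Complex.norm_real, Real.norm_of_nonneg hcpos.le] at this
    rw [this]
    refine norm_integral_le_of_norm_le ?_ ?_
    · rw [← IntegrableOn, ← Ioc_union_Ioi_eq_Ioi hδ.le]
      exact hGi0.union hGi1
    · filter_upwards [ae_restrict_mem measurableSet_Ioi] with s hs
      by_cases h : s ≤ δ
      · simpa only [G, if_pos h] using hB0 s hs
      · simpa only [G, if_neg h] using hB1 s hs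
  have hGv : ∫ s in Ioi (0 : ℝ), G s
      = 2 * M₀ * (δ ^ θ / θ) + M₁ * (δ ^ (θ - 1) / (1 - θ)) := by
    rw [← Ioc_union_Ioi_eq_Ioi hδ.le, setIntegral_union Ioc_disjoint_Ioi_same measurableSet_Ioi
      hGi0 hGi1, setIntegral_congr_fun measurableSet_Ioc hG0,
      setIntegral_congr_fun measurableSet_Ioi hG1, integral_const_mul, integral_const_mul,
      integral_Ioc_rpow_sub_one h0 hδ.le, integral_Ioi_rpow_sub_two h1 hδ]
  rw [hGv] at hle
  refine le_of_mul_le_mul_left (hle.trans ?_) hcpos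
  calc 2 * M₀ * (δ ^ θ / θ) + M₁ * (δ ^ (θ - 1) / (1 - θ))
      = 1 / (2 * θ) * (4 * δ ^ θ * M₀) + 1 / (2 * (1 - θ)) * (2 * δ ^ (θ - 1) * M₁) := by
        field_simp
        ring
    _ ≤ c * (4 * δ ^ θ * M₀) + c * (2 * δ ^ (θ - 1) * M₁) := by gcongr
    _ = _ := by ring

end Dispersive

namespace Dispersive

open Set Laplacian LineDeriv

/-! ### Even powers of `(1 - Δ)^(1/2)` in terms of derivatives -/

theorem norm_iteratedFDeriv_lineDeriv_le {V : Type*} [NormedAddCommGroup V] [NormedSpace ℝ V]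
    (f : 𝓢(V, ℂ)) (v : V) (j : ℕ) (x : V) :
    ‖iteratedFDeriv ℝ j (∂_{v} f : 𝓢(V, ℂ)) x‖ ≤ ‖v‖ * ‖iteratedFDeriv ℝ (j + 1) f x‖ := by
  have h1 : ((∂_{v} f : 𝓢(V, ℂ)) : V → ℂ) = fun y => fderiv ℝ f y v := rfl
  have h2 : ContDiff ℝ ∞ (fderiv ℝ f) := (f.smooth ⊤).fderiv_right (m := ∞) (by simp)
  rw [h1, ← norm_iteratedFDeriv_fderiv]
  exact norm_iteratedFDeriv_clm_apply_const (N := ∞) h2.contDiffAt (by exact_mod_cast le_top)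

/-- The `n` second derivatives in `Δ` each cost `T²`, and `T ≥ 1` absorbs the zeroth-order term:
hence `n + 1`. -/
theorem norm_iteratedFDeriv_bessel_two_le {n m : ℕ} {f : 𝓢(E n, ℂ)} {M T : ℝ} (hT : 1 ≤ T)
    (hf : ∀ j ≤ m + 2, ∀ x, ‖iteratedFDeriv ℝ j f x‖ ≤ M * T ^ j) :
    ∀ j ≤ m, ∀ x, ‖iteratedFDeriv ℝ j (bessel n 2 f) x‖ ≤ (n + 1) * T ^ 2 * M * T ^ j := by
  intro j hj x
  have hM : 0 ≤ M := by simpa using (norm_nonneg _).trans (hf 0 (by omega) 0)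
  have hsum : ∀ (s : Finset (Fin n)) (g : Fin n → 𝓢(E n, ℂ)),
      ‖iteratedFDeriv ℝ j (∑ i ∈ s, g i : 𝓢(E n, ℂ)) x‖
        ≤ ∑ i ∈ s, ‖iteratedFDeriv ℝ j (g i) x‖ := by
    intro s g
    have h1 : ((∑ i ∈ s, g i : 𝓢(E n, ℂ)) : E n → ℂ) = fun y => ∑ i ∈ s, g i y := by
      ext y; simp
    rw [h1, iteratedFDeriv_fun_sum_apply fun i _ => ((g i).smooth j).contDiffAt]
    exact norm_sum_le _ _
  have hΔ : ‖iteratedFDeriv ℝ j (Δ f : 𝓢(E n, ℂ)) x‖ ≤ n * (M * T ^ (j + 2)) := by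
    rw [SchwartzMap.laplacian_eq_sum (EuclideanSpace.basisFun (Fin n) ℝ)]
    refine (hsum _ _).trans ?_
    calc _ ≤ ∑ _i : Fin n, M * T ^ (j + 2) := Finset.sum_le_sum fun i _ => ?_
      _ = _ := by simp
    refine (norm_iteratedFDeriv_lineDeriv_le _ _ _ _).trans ?_
    rw [OrthonormalBasis.norm_eq_one, one_mul]
    refine (norm_iteratedFDeriv_lineDeriv_le _ _ _ _).trans ?_
    rw [OrthonormalBasis.norm_eq_one, one_mul]
    exact hf _ (by omega) x
  rw [bessel_two]
  have h2 : ((f - Δ f : 𝓢(E n, ℂ)) : E n → ℂ) = ⇑f - ⇑(Δ f : 𝓢(E n, ℂ)) := rfl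
  rw [h2, iteratedFDeriv_sub_apply (f.smooth j).contDiffAt ((Δ f : 𝓢(E n, ℂ)).smooth j).contDiffAt]
  refine (norm_sub_le _ _).trans ?_
  have h3 := hf j (by omega) x
  have h4 : M * T ^ j ≤ M * T ^ (j + 2) := by gcongr; omega
  calc _ ≤ M * T ^ (j + 2) + n * (M * T ^ (j + 2)) := add_le_add (h3.trans h4) hΔ
    _ = _ := by ring

theorem norm_iteratedFDeriv_bessel_two_mul_le {n : ℕ} {T : ℝ} (hT : 1 ≤ T) (k : ℕ) :
    ∀ {m : ℕ} {f : 𝓢(E n, ℂ)} {M : ℝ},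
    (∀ j ≤ m + 2 * k, ∀ x, ‖iteratedFDeriv ℝ j f x‖ ≤ M * T ^ j) →
    ∀ j ≤ m, ∀ x, ‖iteratedFDeriv ℝ j (bessel n (2 * k) f) x‖
      ≤ (n + 1) ^ k * T ^ (2 * k) * M * T ^ j := by
  induction k with
  | zero => intro m f M hf j hj x; simpa [bessel_zero] using hf j (by omega) x
  | succ k ih =>
    intro m f M hf j hj x
    have h1 := norm_iteratedFDeriv_bessel_two_le hT (m := m + 2 * k) (fun j hj => hf j (by omega))
    have h2 := ih h1 j hj x
    rw [bessel_bessel] at h2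
    rw [show (2 * ((k + 1 : ℕ) : ℝ)) = 2 * k + 2 by push_cast; ring]
    refine h2.trans_eq ?_
    ring

theorem norm_bessel_two_mul_natCast_le {n : ℕ} {T : ℝ} (hT : 1 ≤ T) {N k : ℕ} (hk : 2 * k ≤ N)
    {f : 𝓢(E n, ℂ)} {M : ℝ} (hf : ∀ j ≤ N, ∀ x, ‖iteratedFDeriv ℝ j f x‖ ≤ M * T ^ j) (x : E n) :
    ‖bessel n (2 * k) f x‖ ≤ (n + 1) ^ N * M * T ^ (2 * k) := by
  have hM : 0 ≤ M := by simpa using (norm_nonneg _).trans (hf 0 (by omega) 0)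
  have h := norm_iteratedFDeriv_bessel_two_mul_le (m := 0) hT k (fun j hj => hf j (by omega))
    0 le_rfl x
  rw [norm_iteratedFDeriv_zero, pow_zero, mul_one] at h
  refine h.trans ?_
  have h1 : ((n : ℝ) + 1) ^ k ≤ (n + 1) ^ N :=
    pow_le_pow_right₀ (by linarith [(Nat.cast_nonneg n : (0 : ℝ) ≤ n)]) (by omega)
  calc _ = ((n : ℝ) + 1) ^ k * M * T ^ (2 * k) := by ring
    _ ≤ _ := by gcongr

/-- If the derivatives of `f` of order `j` are `O(T ^ j)`, then `(1 - Δ)^(α/2) f` is `O(T ^ α)`,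
uniformly for `α` in a bounded interval. -/
theorem norm_bessel_le_of_norm_iteratedFDeriv_le {n N : ℕ} {T : ℝ} (hT : 1 ≤ T) {α : ℝ}
    (hα : 0 ≤ α) (hαN : α + 2 ≤ N) {f : 𝓢(E n, ℂ)} {M : ℝ}
    (hf : ∀ j ≤ N, ∀ x, ‖iteratedFDeriv ℝ j f x‖ ≤ M * T ^ j) (x : E n) :
    ‖bessel n α f x‖ ≤ 6 * ((n + 1) ^ N * M) * T ^ α := by
  have hT0 : 0 < T := by linarith
  have hM : 0 ≤ M := by simpa using (norm_nonneg _).trans (hf 0 (by omega) 0)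
  set M' : ℝ := (n + 1) ^ N * M with hM'
  have hM'0 : 0 ≤ M' := by positivity
  set k := ⌊α / 2⌋₊ with hk
  have hk1 : (k : ℝ) ≤ α / 2 := Nat.floor_le (by positivity)
  have hk2 : α / 2 < k + 1 := Nat.lt_floor_add_one _
  have hkN : 2 * (k + 1) ≤ N := by
    have : (2 * (k + 1) : ℝ) ≤ N := by linarith
    exact_mod_cast this
  have hb : ∀ x, ‖bessel n (2 * k) f x‖ ≤ M' * T ^ (2 * k) := fun x =>
    norm_bessel_two_mul_natCast_le hT (by omega) hf x
  -- When `α` is an even integer there is no fractional part, and the interpolation, which needs `θ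
  -- > 0`, is bypassed.
  rcases hk1.eq_or_lt with h | h
  · have h2 : (2 * k : ℝ) = α := by linarith
    have h3 := hb x
    rw [← Real.rpow_natCast, Nat.cast_mul, Nat.cast_ofNat, h2] at h3
    refine h3.trans ?_
    gcongr
    linarith
  · set θ : ℝ := α / 2 - k with hθ
    have hb1 : ∀ x, ‖bessel n 2 (bessel n (2 * k) f) x‖ ≤ M' * T ^ (2 * (k + 1)) := fun x => by
      have := norm_bessel_two_mul_natCast_le hT hkN hf x
      rw [bessel_bessel]
      rw [show (2 * ((k + 1 : ℕ) : ℝ)) = 2 + 2 * k by push_cast; ring] at this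
      exact this
    -- The split point `δ = T²` balances the two terms: both become multiples of `T^α`.
    have h1 := norm_bessel_two_mul_le (θ := θ) (by linarith) (by linarith)
      (show 0 < T ^ (2 : ℝ) by positivity) hb hb1 x
    rw [bessel_bessel, show 2 * θ + 2 * k = α by rw [hθ]; ring, ← Real.rpow_mul hT0.le,
      ← Real.rpow_mul hT0.le, ← Real.rpow_natCast, ← Real.rpow_natCast] at h1
    refine h1.trans_eq ?_
    have e1 : T ^ α = T ^ (2 * θ) * T ^ ((2 * k : ℕ) : ℝ) := by
      rw [← Real.rpow_add hT0]; congr 1; rw [hθ]; push_cast; ring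
    have e2 : T ^ α = T ^ (2 * (θ - 1)) * T ^ ((2 * (k + 1) : ℕ) : ℝ) := by
      rw [← Real.rpow_add hT0]; congr 1; rw [hθ]; push_cast; ring
    calc _ = 4 * M' * (T ^ (2 * θ) * T ^ ((2 * k : ℕ) : ℝ))
          + 2 * M' * (T ^ (2 * (θ - 1)) * T ^ ((2 * (k + 1) : ℕ) : ℝ)) := by ring
      _ = _ := by rw [← e1, ← e2]; ring

end Dispersive

namespace Dispersive

open Set Filter Topology

/-! ### Derivatives of the potential -/

/-- The normalisation `1 ≤ C` gives `C ≤ C ^ i` for `i ≥ 1`, the form required by the Faà di Bruno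
estimates. -/
theorem exists_norm_iteratedFDerivWithin_le {V W : Type*} [NormedAddCommGroup V] [NormedSpace ℝ V]
    [NormedAddCommGroup W] [NormedSpace ℝ W] {f : V → W} {U K : Set V} (hU : IsOpen U)
    (hf : ContDiffOn ℝ ∞ f U) (hK : IsCompact K) (hKU : K ⊆ U) (N : ℕ) :
    ∃ C : ℝ, 1 ≤ C ∧ ∀ i ≤ N, ∀ x ∈ K, ‖iteratedFDerivWithin ℝ i f U x‖ ≤ C := by
  have h1 : ∀ i : ℕ, ∃ C : ℝ, ∀ x ∈ K, ‖iteratedFDerivWithin ℝ i f U x‖ ≤ C := fun i =>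
    hK.exists_bound_of_continuousOn ((hf.continuousOn_iteratedFDerivWithin
      (by exact_mod_cast le_top) hU.uniqueDiffOn).mono hKU)
  choose C hC using h1
  refine ⟨1 + ∑ i ∈ Finset.range (N + 1), |C i|, ?_, fun i hi x hx => ?_⟩
  · have : 0 ≤ ∑ i ∈ Finset.range (N + 1), |C i| := Finset.sum_nonneg fun _ _ => abs_nonneg _
    linarith
  · have h2 := Finset.single_le_sum (f := fun i => |C i|) (fun _ _ => abs_nonneg _)
      (Finset.mem_range.2 (Nat.lt_succ_of_le hi))
    linarith [hC i x hx, le_abs_self (C i)]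

theorem exists_norm_iteratedFDeriv_le {V W : Type*} [NormedAddCommGroup V] [NormedSpace ℝ V]
    [NormedAddCommGroup W] [NormedSpace ℝ W] {f : V → W} {K : Set V}
    (hf : ContDiff ℝ ∞ f) (hK : IsCompact K) (N : ℕ) :
    ∃ C : ℝ, 1 ≤ C ∧ ∀ i ≤ N, ∀ x ∈ K, ‖iteratedFDeriv ℝ i f x‖ ≤ C := by
  simpa only [iteratedFDerivWithin_univ] using
    exists_norm_iteratedFDerivWithin_le isOpen_univ hf.contDiffOn hK (subset_univ K) N

theorem exists_norm_iteratedFDeriv_comp_cos_le {F : ℝ → ℝ} (hF : ContDiff ℝ ∞ F) (N : ℕ) :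
    ∃ C : ℝ, 0 ≤ C ∧ ∀ i ≤ N, ∀ s, ‖iteratedFDeriv ℝ i (F ∘ Real.cos) s‖ ≤ C := by
  obtain ⟨C, hC1, hC⟩ := exists_norm_iteratedFDeriv_le hF (isCompact_Icc (a := -1) (b := 1)) N
  refine ⟨N.factorial * C, by positivity, fun i hi s => ?_⟩
  have h := norm_iteratedFDeriv_comp_le (n := i) (N := ∞) hF Real.contDiff_cos
    (by exact_mod_cast le_top) s (C := C) (D := 1)
    (fun j hj => hC j (hj.trans hi) _ ⟨Real.neg_one_le_cos s, Real.cos_le_one s⟩)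
    (fun j _ _ => by
      rw [norm_iteratedFDeriv_eq_norm_iteratedDeriv, one_pow]
      exact Real.abs_iteratedDeriv_cos_le_one j s)
  rw [one_pow, mul_one] at h
  refine h.trans ?_
  gcongr

/-- The profile `r ↦ φ(r) F(cos(T r² / 4))`. -/
noncomputable def profile (φ F : ℝ → ℝ) (T r : ℝ) : ℝ :=
  φ r * F (Real.cos (T * (r ^ 2 / 4)))

theorem contDiff_profile {φ F : ℝ → ℝ} (hφ : ContDiff ℝ ∞ φ) (hF : ContDiff ℝ ∞ F) (T : ℝ) :
    ContDiff ℝ ∞ (profile φ F T) := by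
  unfold profile
  fun_prop

/-- Only the phase `T r²/4` carries `T`, and its derivatives on `[a, b]` are at most `Q T`. Faà di
Bruno then yields `T^j`, and in the Leibniz rule the derivatives falling on `φ` cost no power of
`T`. -/
theorem exists_norm_iteratedFDeriv_profile_le {φ F : ℝ → ℝ} {a b : ℝ} (hφ : ContDiff ℝ ∞ φ)
    (hφ_supp : tsupport φ ⊆ Icc a b) (hF : ContDiff ℝ ∞ F) (N : ℕ) :
    ∃ C : ℝ, 0 ≤ C ∧ ∀ T, 1 ≤ T → ∀ i ≤ N, ∀ r,
      ‖iteratedFDeriv ℝ i (profile φ F T) r‖ ≤ C * T ^ i := by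
  obtain ⟨A, hA1, hA⟩ := exists_norm_iteratedFDeriv_le hφ (isCompact_Icc (a := a) (b := b)) N
  obtain ⟨B, hB0, hB⟩ := exists_norm_iteratedFDeriv_comp_cos_le hF N
  obtain ⟨Q, hQ1, hQ⟩ := exists_norm_iteratedFDeriv_le (f := fun r : ℝ => r ^ 2 / 4)
    (by fun_prop) (isCompact_Icc (a := a) (b := b)) N
  refine ⟨2 ^ N * (A * (N.factorial * B * Q ^ N)), by positivity, fun T hT i hi r => ?_⟩
  have hT0 : 0 ≤ T := by linarith
  by_cases hr : r ∈ Icc a b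
  · have hcomp : ∀ j ≤ N, ‖iteratedFDeriv ℝ j (fun r : ℝ => F (Real.cos (T * (r ^ 2 / 4)))) r‖
        ≤ N.factorial * B * Q ^ N * T ^ j := by
      intro j hj
      have h := norm_iteratedFDeriv_comp_le (n := j) (N := ∞) (g := F ∘ Real.cos)
        (f := T • fun r : ℝ => r ^ 2 / 4) (hF.comp Real.contDiff_cos)
        (by fun_prop) (by exact_mod_cast le_top) r (C := B) (D := Q * T)
        (fun l hl => hB l (hl.trans hj) _) (fun l hl1 hl => by
          rw [iteratedFDeriv_const_smul_apply (by fun_prop), norm_smul,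
            Real.norm_of_nonneg hT0, mul_comm]
          calc _ ≤ Q * T := by gcongr; exact hQ l (hl.trans hj) r hr
            _ ≤ (Q * T) ^ l := le_self_pow₀ (one_le_mul_of_one_le_of_one_le hQ1 hT) (by omega))
      refine h.trans ?_
      rw [mul_pow, ← mul_assoc]
      gcongr
    have hmul := norm_iteratedFDeriv_mul_le (N := ∞) (f := φ)
      (g := fun r : ℝ => F (Real.cos (T * (r ^ 2 / 4)))) hφ (by fun_prop) r (n := i)
      (by exact_mod_cast le_top)
    refine hmul.trans ?_
    calc _ ≤ ∑ j ∈ Finset.range (i + 1), (i.choose j : ℝ) *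
          (A * (N.factorial * B * Q ^ N) * T ^ i) := by
          refine Finset.sum_le_sum fun j hj => ?_
          have hji : j ≤ i := Nat.lt_succ_iff.1 (Finset.mem_range.1 hj)
          rw [mul_assoc]
          refine mul_le_mul_of_nonneg_left ?_ (Nat.cast_nonneg _)
          have h2 : T ^ (i - j) ≤ T ^ i := pow_le_pow_right₀ hT (by omega)
          rw [mul_assoc A]
          refine mul_le_mul (hA j (hji.trans hi) r hr) ?_ (norm_nonneg _) (by linarith)
          exact (hcomp (i - j) (by omega)).trans (by gcongr)
      _ = 2 ^ i * (A * (N.factorial * B * Q ^ N)) * T ^ i := by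
          rw [← Finset.sum_mul, ← Nat.cast_sum, Nat.sum_range_choose]
          push_cast
          ring
      _ ≤ _ := by
          gcongr
          norm_num
  · have h1 : tsupport (profile φ F T) ⊆ tsupport φ := tsupport_mul_subset_left
    have h2 : iteratedFDeriv ℝ i (profile φ F T) r = 0 := by
      by_contra h
      exact hr (hφ_supp (h1 (support_iteratedFDeriv_subset i h)))
    rw [h2, norm_zero]
    positivity

/-! ### Geometry of the length sum and composition with the profile -/

theorem continuous_lengthSum (n : ℕ) : Continuous (lengthSum n) := by
  unfold lengthSum
  fun_prop

theorem contDiffOn_lengthSum (n : ℕ) : ContDiffOn ℝ ∞ (lengthSum n) {x₀ n, y₀ n}ᶜ := by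
  intro x hx
  simp only [mem_compl_iff, mem_insert_iff, mem_singleton_iff, not_or] at hx
  refine ContDiffAt.contDiffWithinAt ?_
  unfold lengthSum
  exact ((contDiffAt_const.sub contDiffAt_id).norm ℝ (sub_ne_zero.2 (Ne.symm hx.1))).add
    ((contDiffAt_id.sub contDiffAt_const).norm ℝ (sub_ne_zero.2 hx.2))

theorem norm_x₀ {n : ℕ} (hn : 0 < n) : ‖x₀ n‖ = 1 := by
  have h : x₀ n = EuclideanSpace.single ⟨0, hn⟩ (1 : ℝ) := by
    ext i
    simp [x₀, Fin.ext_iff]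
  rw [h]
  simp

theorem lengthSum_eq (n : ℕ) (x : E n) : lengthSum n x = ‖x - x₀ n‖ + ‖x + x₀ n‖ := by
  rw [lengthSum, norm_sub_rev, y₀, sub_neg_eq_add]

/-- The triangle inequality gives `‖x‖ ≤ L/2 ≤ 4 < 5`. The parallelogram law gives `2‖x‖² + 2 ≥ L²/2
≥ 18`, so `‖x‖² ≥ 8 > (5/2)²`. -/
theorem lengthSum_preimage_Icc_subset_shell {n : ℕ} (hn : 0 < n) :
    lengthSum n ⁻¹' Icc 6 8 ⊆ shell n := by
  rintro x ⟨h6, h8⟩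
  rw [lengthSum_eq] at h6 h8
  have hpar := parallelogram_law_with_norm ℝ x (x₀ n)
  rw [norm_x₀ hn] at hpar
  have htri : 2 * ‖x‖ ≤ ‖x - x₀ n‖ + ‖x + x₀ n‖ := by
    have := norm_add_le (x - x₀ n) (x + x₀ n)
    rw [show x - x₀ n + (x + x₀ n) = (2 : ℝ) • x by rw [two_smul]; abel, norm_smul] at this
    simpa using this
  refine ⟨?_, ?_⟩
  · rw [mem_ball_zero_iff]; linarith
  · rw [mem_ball_zero_iff, not_lt]
    nlinarith [sq_nonneg (‖x - x₀ n‖ - ‖x + x₀ n‖), norm_nonneg x]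

theorem lengthSum_preimage_Icc_subset_compl {n : ℕ} (hn : 0 < n) :
    lengthSum n ⁻¹' Icc 6 8 ⊆ {x₀ n, y₀ n}ᶜ := by
  intro x hx h
  have h1 := (lengthSum_preimage_Icc_subset_shell hn hx).2
  rw [mem_ball_zero_iff, not_lt] at h1
  rcases h with h | h
  · rw [h, norm_x₀ hn] at h1; norm_num at h1
  · rw [mem_singleton_iff.1 h, y₀, norm_neg, norm_x₀ hn] at h1; norm_num at h1

theorem isCompact_lengthSum_preimage_Icc {n : ℕ} (hn : 0 < n) :
    IsCompact (lengthSum n ⁻¹' Icc 6 8) :=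
  Metric.isCompact_of_isClosed_isBounded (isClosed_Icc.preimage (continuous_lengthSum n))
    (Metric.isBounded_ball.subset ((lengthSum_preimage_Icc_subset_shell hn).trans sdiff_subset))

theorem tsupport_profile_comp_lengthSum_subset {n : ℕ} {φ F : ℝ → ℝ}
    (hφ_supp : tsupport φ ⊆ Icc 6 8) (T : ℝ) :
    tsupport (profile φ F T ∘ lengthSum n) ⊆ lengthSum n ⁻¹' Icc 6 8 := by
  refine closure_minimal (fun x hx => ?_) (isClosed_Icc.preimage (continuous_lengthSum n))
  exact hφ_supp (subset_tsupport _ fun h => hx (by simp [profile, h]))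

theorem contDiff_profile_comp_lengthSum {n : ℕ} (hn : 0 < n) {φ F : ℝ → ℝ} (hφ : ContDiff ℝ ∞ φ)
    (hφ_supp : tsupport φ ⊆ Icc 6 8) (hF : ContDiff ℝ ∞ F) (T : ℝ) :
    ContDiff ℝ ∞ (profile φ F T ∘ lengthSum n) := by
  refine contDiff_iff_contDiffAt.2 fun x => ?_
  by_cases hx : x ∈ tsupport (profile φ F T ∘ lengthSum n)
  · have hxU := lengthSum_preimage_Icc_subset_compl hn
      (tsupport_profile_comp_lengthSum_subset hφ_supp T hx)
    exact (contDiff_profile hφ hF T).contDiffAt.comp x ((contDiffOn_lengthSum n).contDiffAt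
      ((toFinite {x₀ n, y₀ n}).isClosed.isOpen_compl.mem_nhds hxU))
  · exact contDiffAt_const (c := (0 : ℝ)).congr_of_eventuallyEq
      (notMem_tsupport_iff_eventuallyEq.1 hx)

theorem exists_norm_iteratedFDeriv_profile_comp_lengthSum_le {n : ℕ} (hn : 0 < n) {φ F : ℝ → ℝ}
    (hφ : ContDiff ℝ ∞ φ) (hφ_supp : tsupport φ ⊆ Icc 6 8) (hF : ContDiff ℝ ∞ F) (N : ℕ) :
    ∃ C : ℝ, 0 ≤ C ∧ ∀ T, 1 ≤ T → ∀ i ≤ N, ∀ x,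
      ‖iteratedFDeriv ℝ i (profile φ F T ∘ lengthSum n) x‖ ≤ C * T ^ i := by
  have hU : IsOpen ({x₀ n, y₀ n}ᶜ : Set (E n)) := (toFinite {x₀ n, y₀ n}).isClosed.isOpen_compl
  obtain ⟨A, hA0, hA⟩ := exists_norm_iteratedFDeriv_profile_le hφ hφ_supp hF N
  obtain ⟨D, hD1, hD⟩ := exists_norm_iteratedFDerivWithin_le hU (contDiffOn_lengthSum n)
    (isCompact_lengthSum_preimage_Icc hn) (lengthSum_preimage_Icc_subset_compl hn) N
  refine ⟨N.factorial * A * D ^ N, by positivity, fun T hT i hi x => ?_⟩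
  by_cases hx : x ∈ lengthSum n ⁻¹' Icc 6 8
  · have hxU := lengthSum_preimage_Icc_subset_compl hn hx
    -- `lengthSum` need not be smooth at the foci, so the chain rule is applied on their open
    -- complement.
    rw [← iteratedFDerivWithin_of_isOpen i hU hxU]
    have h := norm_iteratedFDerivWithin_comp_le (n := i) (N := ∞) (t := univ)
      (contDiff_profile hφ hF T).contDiffOn (contDiffOn_lengthSum n)
      (by exact_mod_cast le_top) uniqueDiffOn_univ hU.uniqueDiffOn (mapsTo_univ _ _) hxU
      (C := A * T ^ i) (D := D)
      (fun j hj => by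
        rw [iteratedFDerivWithin_univ]
        refine (hA T hT j (hj.trans hi) _).trans ?_
        gcongr)
      (fun j hj1 hj => (hD j (hj.trans hi) x hx).trans (le_self_pow₀ hD1 (by omega)))
    refine h.trans ?_
    have hT0 : 0 ≤ T := by linarith
    calc _ ≤ (N.factorial : ℝ) * (A * T ^ i) * D ^ N := by gcongr
      _ = _ := by ring
  · have h2 : iteratedFDeriv ℝ i (profile φ F T ∘ lengthSum n) x = 0 := by
      by_contra h
      exact hx (tsupport_profile_comp_lengthSum_subset hφ_supp T
        (support_iteratedFDeriv_subset i h))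
    rw [h2, norm_zero]
    positivity

/-- A Schwartz function supported in the shell, as an element of `SmoothX n α`. -/
noncomputable def SmoothX.ofMem {n : ℕ} (α : ℝ) (f : 𝓢(E n, ℂ)) (hf : f ∈ smoothOnShell n) :
    SmoothX n α :=
  (⟨f, hf⟩ : smoothOnShell n)

theorem SmoothX.toSchwartz_ofMem {n : ℕ} (α : ℝ) (f : 𝓢(E n, ℂ)) (hf : f ∈ smoothOnShell n) :
    SmoothX.toSchwartz n α (SmoothX.ofMem α f hf) = f :=
  rfl

theorem SmoothX.norm_le {n : ℕ} {α M : ℝ} (hM : 0 ≤ M) (V : SmoothX n α)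
    (hV : ∀ x, ‖bessel n α (SmoothX.toSchwartz n α V) x‖ ≤ M) : ‖V‖ ≤ M :=
  (BoundedContinuousFunction.norm_le (f := SmoothX.toBounded n α V) hM).2 hV

end Dispersive

/-! ### Choice of the constant and the norm bound -/

theorem proposition5 (n : ℕ) (hn : 3 < n) (φ F : ℝ → ℝ)
    (hφ : ContDiff ℝ ∞ φ) (hφ_supp : tsupport φ ⊆ Set.Icc 6 8)
    (hF : ContDiff ℝ ∞ F) (hF_nonneg : ∀ s, 0 ≤ F s)
    (hF_zero : ∀ s, s ≤ 0 → F s = 0) (hF_id : ∀ s, 1 / 2 ≤ s → F s = s) :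
    ∃ C : ℝ, 0 < C ∧
      ∀ α : ℝ, 0 ≤ α → α < ((n : ℝ) - 3) / 2 →
        ∀ t : ℝ, 0 < t → t ≤ 1 →
          ∃ V : Dispersive.SmoothX n α,
            (∀ x, Dispersive.SmoothX.toSchwartz n α V x
              = (Dispersive.potential n φ F C α t x : ℂ)) ∧
            ‖(V : Dispersive.X n α)‖ ≤ 1 := by
  have hn0 : 0 < n := by omega
  -- Derivatives up to order `n` suffice for every admissible `α`, as `α + 2 < (n + 1)/2 ≤ n`; hence
  -- `M` is fixed before `α` and `t`.
  obtain ⟨M, hM0, hM⟩ := Dispersive.exists_norm_iteratedFDeriv_profile_comp_lengthSum_le hn0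
    hφ hφ_supp hF n
  set B : ℝ := 6 * ((n + 1) ^ n * M) with hB
  have hB0 : 0 ≤ B := by positivity
  -- `B + 1` rather than `B`, since `B` may vanish.
  refine ⟨1 / (B + 1), by positivity, fun α hα hαn t ht ht1 => ?_⟩
  have hn3 : (3 : ℝ) < n := by exact_mod_cast hn
  have hT : 1 ≤ t⁻¹ := (one_le_inv₀ ht).2 ht1
  set w : Dispersive.E n → ℝ := Dispersive.profile φ F t⁻¹ ∘ Dispersive.lengthSum n with hw
  have hw_supp : tsupport w ⊆ Dispersive.lengthSum n ⁻¹' Set.Icc 6 8 :=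
    Dispersive.tsupport_profile_comp_lengthSum_subset hφ_supp t⁻¹
  have hw_smooth : ContDiff ℝ ∞ w :=
    Dispersive.contDiff_profile_comp_lengthSum hn0 hφ hφ_supp hF t⁻¹
  have hwc_smooth : ContDiff ℝ ∞ (fun x => (w x : ℂ)) :=
    Complex.ofRealCLM.contDiff.comp hw_smooth
  have hwc_supp : tsupport (fun x => (w x : ℂ)) ⊆ Dispersive.lengthSum n ⁻¹' Set.Icc 6 8 :=
    (closure_mono (Function.support_comp_subset (g := fun r : ℝ => (r : ℂ)) rfl w)).trans hw_supp
  have hwc_compact : HasCompactSupport (fun x => (w x : ℂ)) :=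
    (Dispersive.isCompact_lengthSum_preimage_Icc hn0).of_isClosed_subset isClosed_closure hwc_supp
  set W : 𝓢(Dispersive.E n, ℂ) := hwc_compact.toSchwartzMap hwc_smooth with hW
  have hW_mem : W ∈ Dispersive.smoothOnShell n :=
    hwc_supp.trans (Dispersive.lengthSum_preimage_Icc_subset_shell hn0)
  have hW_deriv : ∀ j ≤ n, ∀ x, ‖iteratedFDeriv ℝ j W x‖ ≤ M * t⁻¹ ^ j := fun j hj x =>
    (Complex.ofRealLI.norm_iteratedFDeriv_comp_left (n := ∞) hw_smooth.contDiffAt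
      (by exact_mod_cast le_top)).trans_le (hM _ hT j hj x)
  have hW_bessel := Dispersive.norm_bessel_le_of_norm_iteratedFDeriv_le hT hα
    (by linarith) hW_deriv
  set c : ℝ := 1 / (B + 1) * t ^ α with hc
  have hc0 : 0 ≤ c := by positivity
  refine ⟨Dispersive.SmoothX.ofMem α ((c : ℂ) • W) (Submodule.smul_mem _ _ hW_mem),
    fun x => ?_, ?_⟩
  · change (c : ℂ) * (w x : ℂ) = _
    rw [← Complex.ofReal_mul, hw, Function.comp_apply, Dispersive.profile, Dispersive.potential,
      hc, show t⁻¹ * (Dispersive.lengthSum n x ^ 2 / 4) = Dispersive.lengthSum n x ^ 2 / (4 * t) by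
        field_simp]
    push_cast
    ring
  · rw [UniformSpace.Completion.norm_coe]
    refine Dispersive.SmoothX.norm_le zero_le_one _ fun x => ?_
    rw [Dispersive.SmoothX.toSchwartz_ofMem, map_smul, smul_apply, norm_smul, Complex.norm_real, Real.norm_of_nonneg hc0]
    calc c * ‖Dispersive.bessel n α W x‖ ≤ c * (B * t⁻¹ ^ α) := by gcongr; exact hW_bessel x
      _ = B / (B + 1) * (t ^ α * t⁻¹ ^ α) := by rw [hc]; ring
      _ = B / (B + 1) := by
        rw [← Real.mul_rpow ht.le (by positivity), mul_inv_cancel₀ ht.ne', Real.one_rpow, mul_one]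
      _ ≤ 1 := (div_le_one (by positivity)).2 (by linarith)
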